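/- Let $n\ge 0$, let $F_n$ be the free group on $t_1,\dots,t_n$, let $\Lambda=\mathbb Z[\mathbb Z^n]=\mathbb Z[t_1^{\pm1},\dots,t_n^{\pm1}]$, let $C_1=\Lambda^n$ with standard basis $e_1,\dots,e_n$, and let $C_k=\bigwedge^k C_1$ with basis $e_J=e_{j_1}\wedge\dots\wedge e_{j_k}$ for $J=\{j_1<\dots<j_k\}$. Let $d_k:C_k\to C_{k-1}$ be the $\Lambda$-linear map $$d_k(e_J)=\sum_{r=1}^k(-1)^{k+r}(t_{j_r}-1)\,e_{J\setminus\{j_r\}} .$$ For $w\in F_n$ let $\nabla(w)=(\partial w/\partial t_1,\dots,\partial w/\partial t_n)\in(\mathbb ZF_n)^n$ be the Fox gradient, determined by $\nabla(t_i)=e_i$ and $\nabla(uv)=\nabla(u)+u\nabla(v)$ for $u,v\in F_n$, and let $\nabla^{\mathrm{ab}}(w)\in C_1$ be its image under the abelianization $F_n\to\mathbb Z^n$. For a group $G$, the Alexander invariant is $B(G)=G'/G''$, a $\mathbb Z[G/G']$-module in which the class of $g\in G$ acts by $x\mapsto gxg^{-1}$. For automorphisms $\alpha_1,\dots,\alpha_s$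 of $F_n$ ($s\ge0$) let $$G(\alpha_1,\dots,\alpha_s)=\langle t_1,\dots,t_n\mid t_i=\alpha_k(t_i),\ 1\le i\le n,\ 1\le k\le s\rangle .$$ **Theorem.** Let $\gamma_1,\dots,\gamma_s$ be basis-conjugating automorphisms of $F_n$, and let $z^k=(z^k_1,\dots,z^k_n)$ be any $n$-tuples of elements of $F_n$ with $\gamma_k(t_i)=z^k_i\,t_i\,(z^k_i)^{-1}$ for all $i$ and $k$. Let $G=G(\gamma_1,\dots,\gamma_s)$. Then sending the $i$-th generator of $\mathbb Z^n$ to the class of $t_i$ defines an isomorphism $\mathbb Z^n\cong G/G'$, which makes $B=B(G)$ a $\Lambda$-module. Let $\Phi_k:C_1\to C_2$ be the $\Lambda$-linear map with $\Phi_k(e_i)=\nabla^{\mathrm{ab}}(z^k_i)\wedge e_i$. There is an exact sequence of $\Lambda$-modules $$C_1^s\oplus C_3\xrightarrow{\ (c_1,\dots,c_s,c)\,\mapsto\,\sum_k\Phi_k(c_k)+d_3(c)\ }C_2\longrightarrow B\longrightarrow 0 .$$ Here $C_2$ is free of rank $\binom n2$ and $C_1^s\oplus C_3$ is free of rank $\binom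 n3+ns$, so this is a presentation of $B$ with $\binom n2$ generators and $\binom n3+ns$ relations. In particular, let $\beta\in P_n$ be a pure braid, where the braid group $B_n$ acts on $F_n$ through the Artin representation $\sigma_i:\ t_i\mapsto t_it_{i+1}t_i^{-1},\ t_{i+1}\mapsto t_i$, with all other $t_j$ fixed. Then $\beta$ acts as a basis-conjugating automorphism $t_i\mapsto z_it_iz_i^{-1}$ for some $z_1,\dots,z_n\in F_n$, and the above applies, with $s=1$, to the group $G(\beta)=\langle t_1,\dots,t_n\mid t_i=\beta(t_i)\rangle$ (by Artin's theorem, the group of the pure link that is the closure of $\beta$). -/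

import Mathlib

noncomputable section

namespace AlexFree

/-! ### The Alexander invariant of a group -/

/-- The Alexander invariant `B(G) = G'/G''` of a group `G`, written additively. -/
def AlexInv (G : Type*) [Group G] : Type _ := Additive (Abelianization (commutator G))

instance (G : Type*) [Group G] : AddCommGroup (AlexInv G) :=
  inferInstanceAs (AddCommGroup (Additive (Abelianization (commutator G))))

/-- The class in `G'/G''` of an element of `G'`. -/
def AlexInv.mk {G : Type*} [Group G] (x : commutator G) : AlexInv G :=
  Additive.ofMul (Abelianization.of x)

theorem AlexInv.mk_surjective {G : Type*} [Group G] :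
    Function.Surjective (AlexInv.mk (G := G)) := by
  intro b
  obtain ⟨x, hx⟩ := QuotientGroup.mk_surjective (Additive.toMul b)
  exact ⟨x, congrArg Additive.ofMul hx⟩

/-- The endomorphism of `G'/G''` induced by the conjugation `x ↦ g x g⁻¹`. -/
def conjEnd (G : Type*) [Group G] (g : G) : Module.End ℤ (AlexInv G) :=
  AddMonoidHom.toIntLinearMap (M := AlexInv G) (M₂ := AlexInv G)
    (MonoidHom.toAdditive
      (Abelianization.map (MulAut.conjNormal (H := commutator G) g).toMonoidHom))

theorem conjEnd_mk {G : Type*} [Group G] (g : G) (x : commutator G) :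
    conjEnd G g (AlexInv.mk x) = AlexInv.mk (MulAut.conjNormal g x) := rfl

/-- Conjugation as an action of `G` on `G'/G''`. -/
def conjHom (G : Type*) [Group G] : G →* Module.End ℤ (AlexInv G) where
  toFun := conjEnd G
  map_one' := by
    ext b
    obtain ⟨x, rfl⟩ := AlexInv.mk_surjective b
    simp [conjEnd_mk]
  map_mul' g h := by
    ext b
    obtain ⟨x, rfl⟩ := AlexInv.mk_surjective b
    simp [conjEnd_mk]

/-- The action of `G/G'` on `G'/G''` defined by the extension
`1 → G'/G'' → G/G'' → G/G' → 1`. -/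
def abConj (G : Type*) [Group G] : Abelianization G →* Module.End ℤ (AlexInv G) :=
  QuotientGroup.lift (commutator G) (conjHom G) (by
    intro g hg
    rw [MonoidHom.mem_ker]
    ext b
    obtain ⟨x, rfl⟩ := AlexInv.mk_surjective b
    have h : MulAut.conjNormal g x = (⟨g, hg⟩ : commutator G) * x * (⟨g, hg⟩)⁻¹ :=
      Subtype.ext (by simp)
    have h2 : Abelianization.of (MulAut.conjNormal g x) = Abelianization.of x := by
      rw [h, map_mul, map_mul, map_inv, mul_comm, inv_mul_cancel_left]
    exact congrArg Additive.ofMul h2)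

/-- `B(G)` as a module over the integral group ring of `G/G'`. -/
instance (G : Type*) [Group G] : Module (MonoidAlgebra ℤ (Abelianization G)) (AlexInv G) :=
  Module.compHom (AlexInv G)
    (MonoidAlgebra.lift ℤ (Module.End ℤ (AlexInv G)) (Abelianization G) (abConj G)).toRingHom

theorem single_smul_mk {G : Type*} [Group G] (g : G) (x : commutator G) :
    MonoidAlgebra.single (Abelianization.of g) (1 : ℤ) • AlexInv.mk x =
      AlexInv.mk (MulAut.conjNormal g x) := by
  change (MonoidAlgebra.lift ℤ (Module.End ℤ (AlexInv G)) (Abelianization G) (abConj G))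
    (MonoidAlgebra.single (Abelianization.of g) (1 : ℤ)) (AlexInv.mk x) = _
  rw [MonoidAlgebra.lift_single, one_smul]
  rfl

/-! ### Laurent polynomials and the standard resolution -/

/-- The group `ℤⁿ`, written multiplicatively. -/
abbrev ZPow (n : ℕ) : Type := Multiplicative (Fin n → ℤ)

/-- The generator `t_i` of `ℤⁿ`. -/
def tGen {n : ℕ} (i : Fin n) : ZPow n := Multiplicative.ofAdd (Pi.single i 1)

/-- `Λ = ℤ[ℤⁿ] = ℤ[t_1^{±1}, …, t_n^{±1}]`. -/
abbrev Lam (n : ℕ) : Type := MonoidAlgebra ℤ (ZPow n)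

/-- The Laurent polynomial `t_i`. -/
def tvar {n : ℕ} (i : Fin n) : Lam n := MonoidAlgebra.single (tGen i) 1

/-- `C_1 = Λⁿ`. -/
abbrev C1 (n : ℕ) : Type := Fin n → Lam n

/-- The standard basis `e_1, …, e_n` of `C_1`. -/
def e {n : ℕ} : Module.Basis (Fin n) (Lam n) (C1 n) := Pi.basisFun (Lam n) (Fin n)

/-- `C_k = ⋀ᵏ C_1`. -/
abbrev C (n k : ℕ) : Type := ⋀[Lam n]^k (C1 n)

/-- The basis `e_J = e_{j_1} ∧ ⋯ ∧ e_{j_k}` (`j_1 < ⋯ < j_k`) of `C_k`, indexed by the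
`k`-element subsets `J` of the index set. -/
def eBasis (n k : ℕ) : Module.Basis (Set.powersetCard (Fin n) k) (Lam n) (C n k) :=
  e.exteriorPower k

/-- The differential `d_{k+1} : C_{k+1} → C_k` of the standard resolution,
`d_{k+1}(e_J) = ∑_r (-1)^{(k+1)+r} (t_{j_r} - 1) e_{J ∖ {j_r}}`, `r = 1, …, k+1`.
The index `r` of the code starts at `0`. -/
def d (n k : ℕ) : C n (k + 1) →ₗ[Lam n] C n k :=
  (eBasis n (k + 1)).constr ℤ fun J =>
    let j : Fin (k + 1) ↪o Fin n := Set.powersetCard.ofFinEmbEquiv.symm J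
    ∑ r : Fin (k + 1), ((-1 : Lam n) ^ ((k + 1) + ((r : ℕ) + 1)) * (tvar (j r) - 1)) •
      exteriorPower.ιMulti (Lam n) k fun i => e (j (r.succAbove i))

/-! ### Fox calculus -/

/-- The free group `F_n` on `t_1, …, t_n`. -/
abbrev F (n : ℕ) : Type := FreeGroup (Fin n)

/-- The integral group ring of `F_n`. -/
abbrev ZF (n : ℕ) : Type := MonoidAlgebra ℤ (F n)

/-- Left multiplication by the elements of `F_n` on `(ℤF_n)ⁿ`. -/
def foxAct (n : ℕ) : F n →* MulAut (Multiplicative (Fin n → ZF n)) where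
  toFun g :=
    { toFun := fun v => Multiplicative.ofAdd
        (MonoidAlgebra.single g (1 : ℤ) • Multiplicative.toAdd v)
      invFun := fun v => Multiplicative.ofAdd
        (MonoidAlgebra.single g⁻¹ (1 : ℤ) • Multiplicative.toAdd v)
      left_inv := fun v => by
        simp [smul_smul, MonoidAlgebra.single_mul_single, ← MonoidAlgebra.one_def]
      right_inv := fun v => by
        simp [smul_smul, MonoidAlgebra.single_mul_single, ← MonoidAlgebra.one_def]
      map_mul' := fun v w => by simp [smul_add] }
  map_one' := by
    ext v
    simp [← MonoidAlgebra.one_def]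
  map_mul' g h := by
    ext v
    simp [smul_smul, MonoidAlgebra.single_mul_single]

/-- The homomorphism `w ↦ (∇ w, w)` from `F_n` to the semidirect product of `(ℤF_n)ⁿ` and `F_n`
that sends `t_i` to `(e_i, t_i)`. -/
def foxHom (n : ℕ) : F n →* Multiplicative (Fin n → ZF n) ⋊[foxAct n] F n :=
  FreeGroup.lift fun i => ⟨Multiplicative.ofAdd (Pi.single i 1), FreeGroup.of i⟩

/-- The Fox gradient `∇ w = (∂w/∂t_1, …, ∂w/∂t_n)` of an element `w` of `F_n`. -/
def foxGrad {n : ℕ} (w : F n) : Fin n → ZF n := Multiplicative.toAdd (foxHom n w).left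

theorem foxHom_right {n : ℕ} (w : F n) : (foxHom n w).right = w := by
  have h : SemidirectProduct.rightHom.comp (foxHom n) = MonoidHom.id (F n) := by
    ext i
    simp [foxHom]
  exact DFunLike.congr_fun h w

theorem foxGrad_of {n : ℕ} (i : Fin n) : foxGrad (FreeGroup.of i) = Pi.single i 1 := by
  simp [foxGrad, foxHom]

theorem foxGrad_mul {n : ℕ} (u v : F n) :
    foxGrad (u * v) = foxGrad u + MonoidAlgebra.single u (1 : ℤ) • foxGrad v := by
  have h : foxHom n (u * v) = foxHom n u * foxHom n v := (foxHom n).map_mul u v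
  rw [foxGrad, h, SemidirectProduct.mul_left, foxHom_right]
  rfl

/-- The fundamental formula of Fox calculus, `w - 1 = ∑ (∂w/∂t_i) (t_i - 1)`. -/
theorem foxGrad_fundamental {n : ℕ} (w : F n) :
    MonoidAlgebra.single w (1 : ℤ) - 1 =
      ∑ i, foxGrad w i * (MonoidAlgebra.single (FreeGroup.of i) (1 : ℤ) - 1) := by
  have one : foxGrad (1 : F n) = 0 := by simp [foxGrad]
  have mul : ∀ u v : F n,
      (MonoidAlgebra.single u (1 : ℤ) - 1 =
        ∑ i, foxGrad u i * (MonoidAlgebra.single (FreeGroup.of i) (1 : ℤ) - 1)) →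
      (MonoidAlgebra.single v (1 : ℤ) - 1 =
        ∑ i, foxGrad v i * (MonoidAlgebra.single (FreeGroup.of i) (1 : ℤ) - 1)) →
      (MonoidAlgebra.single (u * v) (1 : ℤ) - 1 =
        ∑ i, foxGrad (u * v) i * (MonoidAlgebra.single (FreeGroup.of i) (1 : ℤ) - 1)) := by
    intro u v hu hv
    have h : (MonoidAlgebra.single (u * v) (1 : ℤ) - 1 : ZF n) =
        (MonoidAlgebra.single u (1 : ℤ) - 1) +
          MonoidAlgebra.single u (1 : ℤ) * (MonoidAlgebra.single v (1 : ℤ) - 1) := by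
      rw [mul_sub, MonoidAlgebra.single_mul_single]
      simp
    rw [h, hu, hv, foxGrad_mul, Finset.mul_sum, ← Finset.sum_add_distrib]
    refine Finset.sum_congr rfl fun i _ => ?_
    simp [add_mul, mul_assoc]
  have of : ∀ j : Fin n, (MonoidAlgebra.single (FreeGroup.of j) (1 : ℤ) - 1 : ZF n) =
      ∑ i, foxGrad (FreeGroup.of j) i *
        (MonoidAlgebra.single (FreeGroup.of i) (1 : ℤ) - 1) := by
    intro j
    simp [foxGrad_of, Pi.single_apply]
  induction w using FreeGroup.induction_on with
  | C1 => simp [one, ← MonoidAlgebra.one_def]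
  | of j => exact of j
  | inv_of j hj =>
    have h : foxGrad (FreeGroup.of j)⁻¹ =
        -(MonoidAlgebra.single (FreeGroup.of j)⁻¹ (1 : ℤ) • foxGrad (FreeGroup.of j)) := by
      have h1 := foxGrad_mul (FreeGroup.of j)⁻¹ (FreeGroup.of j)
      rw [inv_mul_cancel, one] at h1
      exact eq_neg_of_add_eq_zero_left h1.symm
    have h2 : ∀ i, foxGrad (FreeGroup.of j)⁻¹ i =
        -(MonoidAlgebra.single (FreeGroup.of j)⁻¹ (1 : ℤ) * foxGrad (FreeGroup.of j) i) := by
      intro i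
      rw [h]
      rfl
    simp only [h2, neg_mul, Finset.sum_neg_distrib, mul_assoc, ← Finset.mul_sum]
    rw [← of j, mul_sub, MonoidAlgebra.single_mul_single]
    simp [← MonoidAlgebra.one_def]
  | mul u v hu hv => exact mul u v hu hv

/-- The abelianization homomorphism `F_n → ℤⁿ`. -/
def abF (n : ℕ) : F n →* ZPow n := FreeGroup.lift tGen

/-- The abelianized Fox gradient `∇^ab(z)` in `C_1 = Λⁿ`. -/
def foxAb {n : ℕ} (z : F n) : C1 n :=
  fun i => MonoidAlgebra.mapDomainRingHom ℤ (abF n) (foxGrad z i)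

/-! ### Groups of basis-conjugating automorphisms -/

/-- `γ` is the basis-conjugating automorphism `γ_z : t_i ↦ z_i t_i z_i⁻¹`. -/
def IsBasisConj {n : ℕ} (γ : MulAut (F n)) (z : Fin n → F n) : Prop :=
  ∀ i, γ (FreeGroup.of i) = z i * FreeGroup.of i * (z i)⁻¹

/-- The `Λ`-linear map `Φ(γ_z) : C_1 → C_2`, `e_i ↦ ∇^ab(z_i) ∧ e_i`. -/
def Phi {n : ℕ} (z : Fin n → F n) : C1 n →ₗ[Lam n] C n 2 :=
  e.constr ℤ fun i => exteriorPower.ιMulti (Lam n) 2 ![foxAb (z i), e i]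

/-- The map `C_1^s ⊕ C_3 → C_2` with components `Φ(γ_{z^1}), …, Φ(γ_{z^s}), d_3`. -/
def presMap {n s : ℕ} (z : Fin s → Fin n → F n) :
    ((Fin s → C1 n) × C n 3) →ₗ[Lam n] C n 2 :=
  (∑ k, Phi (z k) ∘ₗ LinearMap.proj k).coprod (d n 2)

/-- The relators `t_i α_k(t_i)⁻¹`. -/
def autRels {n s : ℕ} (α : Fin s → MulAut (F n)) : Set (F n) :=
  {r | ∃ k i, r = FreeGroup.of i * (α k (FreeGroup.of i))⁻¹}

/-- `G(α_1, …, α_s) = ⟨t_1, …, t_n ∣ t_i = α_k(t_i)⟩`. -/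
abbrev AutGroup {n s : ℕ} (α : Fin s → MulAut (F n)) : Type := PresentedGroup (autRels α)

/-- The homomorphism from `ℤⁿ` to the abelianization of `G(α_1, …, α_s)` that sends the
generator `t_i` to the class of `t_i`. -/
def toAb {n s : ℕ} (α : Fin s → MulAut (F n)) : ZPow n →* Abelianization (AutGroup α) where
  toFun v := ∏ i, Abelianization.of (PresentedGroup.of (rels := autRels α) i) ^
    (Multiplicative.toAdd v i)
  map_one' := by simp
  map_mul' v w := by simp [zpow_add, Finset.prod_mul_distrib]

theorem toAb_tGen {n s : ℕ} (α : Fin s → MulAut (F n)) (i : Fin n) :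
    toAb α (tGen i) = Abelianization.of (PresentedGroup.of i) := by
  simp [toAb, tGen, Pi.single_apply]

/-- The `Λ`-module structure on the Alexander invariant of `G(α_1, …, α_s)`: the variable `t_i`
acts as the class of the generator `t_i` in `G/G'`. -/
instance {n s : ℕ} (α : Fin s → MulAut (F n)) : Module (Lam n) (AlexInv (AutGroup α)) :=
  Module.compHom (AlexInv (AutGroup α)) (MonoidAlgebra.mapDomainRingHom ℤ (toAb α))

theorem tvar_smul_mk {n s : ℕ} (α : Fin s → MulAut (F n)) (i : Fin n)
    (x : commutator (AutGroup α)) :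
    (tvar i : Lam n) • AlexInv.mk x =
      AlexInv.mk (MulAut.conjNormal (PresentedGroup.of (rels := autRels α) i) x) := by
  change MonoidAlgebra.mapDomainRingHom ℤ (toAb α) (tvar i) • AlexInv.mk x = _
  rw [tvar, MonoidAlgebra.mapDomainRingHom_apply, MonoidAlgebra.mapDomain_single, toAb_tGen,
    single_smul_mk]

/-- `K → L → B → 0` is a presentation of `B` for some linear map `L → B`, the map `K → L`
being the given `Δ`. -/
def IsPresentedBy {R K L : Type*} [CommRing R] [AddCommGroup K] [Module R K]
    [AddCommGroup L] [Module R L] (Δ : K →ₗ[R] L) (B : Type*) [AddCommGroup B] [Module R B] :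
    Prop :=
  ∃ p : L →ₗ[R] B, Function.Exact Δ p ∧ Function.Surjective p

/-! ### Pure braids -/

/-- The strand number `i` (from `0`) and the next one, for a generator `σ_i` of `B_n`. -/
def lo {n : ℕ} (i : Fin (n - 1)) : Fin n := ⟨i, by omega⟩

/-- See `lo`. -/
def hi {n : ℕ} (i : Fin (n - 1)) : Fin n := ⟨i + 1, by omega⟩

/-- The relators of the standard presentation of the braid group `B_n`. -/
def braidRels (n : ℕ) : Set (FreeGroup (Fin (n - 1))) :=
  {r | ∃ i j : Fin (n - 1), (i : ℕ) + 1 < j ∧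
      r = FreeGroup.of i * FreeGroup.of j * (FreeGroup.of j * FreeGroup.of i)⁻¹} ∪
  {r | ∃ i j : Fin (n - 1), (i : ℕ) + 1 = j ∧
      r = FreeGroup.of i * FreeGroup.of j * FreeGroup.of i *
        (FreeGroup.of j * FreeGroup.of i * FreeGroup.of j)⁻¹}

/-- The braid group `B_n`. -/
abbrev BraidGroup (n : ℕ) : Type := PresentedGroup (braidRels n)

/-- The permutation of the strands defined by a braid. -/
def braidPerm (n : ℕ) : BraidGroup n →* Equiv.Perm (Fin n) :=
  PresentedGroup.toGroup (f := fun i => Equiv.swap (lo i) (hi i)) (by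
    rintro r (⟨i, j, hij, rfl⟩ | ⟨i, j, hij, rfl⟩)
    · simp only [map_mul, map_inv, FreeGroup.lift_apply_of, mul_inv_eq_one]
      ext x
      simp only [Equiv.Perm.mul_apply, Equiv.swap_apply_def, lo, hi, Fin.ext_iff]
      grind
    · simp only [map_mul, map_inv, FreeGroup.lift_apply_of, mul_inv_eq_one]
      ext x
      simp only [Equiv.Perm.mul_apply, Equiv.swap_apply_def, lo, hi, Fin.ext_iff]
      grind)

/-- The pure braid group `P_n`. -/
def pureBraid (n : ℕ) : Subgroup (BraidGroup n) := (braidPerm n).ker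

/-- The endomorphism `t_i ↦ t_i t_{i+1} t_i⁻¹`, `t_{i+1} ↦ t_i` of `F_n`. -/
def artinFwd {n : ℕ} (i : Fin (n - 1)) : F n →* F n :=
  FreeGroup.lift fun a =>
    if a = lo i then FreeGroup.of (lo i) * FreeGroup.of (hi i) * (FreeGroup.of (lo i))⁻¹
    else if a = hi i then FreeGroup.of (lo i) else FreeGroup.of a

/-- The inverse of `artinFwd`: `t_i ↦ t_{i+1}`, `t_{i+1} ↦ t_{i+1}⁻¹ t_i t_{i+1}`. -/
def artinBwd {n : ℕ} (i : Fin (n - 1)) : F n →* F n :=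
  FreeGroup.lift fun a =>
    if a = lo i then FreeGroup.of (hi i)
    else if a = hi i then (FreeGroup.of (hi i))⁻¹ * FreeGroup.of (lo i) * FreeGroup.of (hi i)
    else FreeGroup.of a

theorem lo_ne_hi {n : ℕ} (i : Fin (n - 1)) : lo i ≠ hi i := by
  simp [lo, hi]

/-- The Artin automorphism `σ_i` of `F_n`. -/
def artinGen {n : ℕ} (i : Fin (n - 1)) : MulAut (F n) :=
  MonoidHom.toMulEquiv (artinFwd i) (artinBwd i)
    (by
      ext a
      have h := lo_ne_hi i
      by_cases h1 : a = lo i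
      · subst h1
        simp [artinFwd, artinBwd, h.symm, mul_assoc]
      · by_cases h2 : a = hi i
        · subst h2
          simp [artinFwd, artinBwd, h.symm]
        · simp [artinFwd, artinBwd, h1, h2])
    (by
      ext a
      have h := lo_ne_hi i
      by_cases h1 : a = lo i
      · subst h1
        simp [artinFwd, artinBwd, h.symm]
      · by_cases h2 : a = hi i
        · subst h2
          simp [artinFwd, artinBwd, h.symm, mul_assoc]
        · simp [artinFwd, artinBwd, h1, h2])

theorem artinGen_of {n : ℕ} (i : Fin (n - 1)) (a : Fin n) :
    artinGen i (FreeGroup.of a) =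
      if a = lo i then FreeGroup.of (lo i) * FreeGroup.of (hi i) * (FreeGroup.of (lo i))⁻¹
      else if a = hi i then FreeGroup.of (lo i) else FreeGroup.of a := by
  change artinFwd i (FreeGroup.of a) = _
  rw [artinFwd, FreeGroup.lift_apply_of]

theorem mulAut_ext {n : ℕ} {f g : MulAut (F n)}
    (h : ∀ a, f (FreeGroup.of a) = g (FreeGroup.of a)) : f = g := by
  have : f.toMonoidHom = g.toMonoidHom := FreeGroup.ext_hom _ _ h
  exact MulEquiv.ext fun x => DFunLike.congr_fun this x

/-- The Artin representation of the braid group `B_n` by automorphisms of `F_n`. -/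
def artin (n : ℕ) : BraidGroup n →* MulAut (F n) :=
  PresentedGroup.toGroup (f := artinGen) (by
    rintro r (⟨i, j, hij, rfl⟩ | ⟨i, j, hij, rfl⟩)
    · simp only [map_mul, map_inv, FreeGroup.lift_apply_of, mul_inv_eq_one]
      have h1 : lo i ≠ lo j := by simp [lo]; omega
      have h2 : lo i ≠ hi j := by simp [lo, hi]; omega
      have h3 : hi i ≠ lo j := by simp [lo, hi]; omega
      have h4 : hi i ≠ hi j := by simp [hi]; omega
      have hi' := lo_ne_hi i
      have hj' := lo_ne_hi j
      refine mulAut_ext fun a => ?_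
      by_cases a1 : a = lo i
      · subst a1; simp [artinGen_of, *]
      by_cases a2 : a = hi i
      · subst a2; simp [artinGen_of, *, hi'.symm]
      by_cases a3 : a = lo j
      · subst a3; simp [artinGen_of, *, h1.symm, h2.symm, h3.symm, h4.symm]
      by_cases a4 : a = hi j
      · subst a4; simp [artinGen_of, *, h1.symm, h2.symm, h3.symm, h4.symm, hj'.symm]
      simp [artinGen_of, *]
    · simp only [map_mul, map_inv, FreeGroup.lift_apply_of, mul_inv_eq_one]
      have h0 : lo j = hi i := by simp [lo, hi, hij]
      have h1 : lo i ≠ hi i := lo_ne_hi i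
      have h2 : hi i ≠ hi j := h0 ▸ lo_ne_hi j
      have h3 : lo i ≠ hi j := by simp [lo, hi]; omega
      refine mulAut_ext fun a => ?_
      by_cases a1 : a = lo i
      · subst a1; simp [artinGen_of, h0, h1, h1.symm, h2.symm, h3, h3.symm, mul_assoc]
      by_cases a2 : a = hi i
      · subst a2; simp [artinGen_of, h0, h1, h1.symm, h2.symm, h3, h3.symm, mul_assoc]
      by_cases a4 : a = hi j
      · subst a4; simp [artinGen_of, h0, h1, h1.symm, h2.symm, h3, h3.symm, mul_assoc]
      simp [artinGen_of, h0, a1, a2, a4])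

end AlexFree

end

/-!
The sequence is proved exact without the Magnus embedding of `F_n/F_n''`.

Write `[u, v]` also for the class in `B(G)` of the commutator of the images of `u, v ∈ F_n`. These
classes are crossed homomorphisms in `u` and in `v`, and the abelianized Fox gradient is one too.
The map `toAlex : C_2 → B(G)` with `e_i ∧ e_j ↦ [t_j, t_i]` therefore sends `∇u ∧ ∇v` to `[v, u]`
for all words `u, v` (`toAlex_foxAb`). It follows at once that `toAlex` is onto. It also kills
`∇z_i ∧ e_i`, which goes to the class of the relator `[t_i, z_i] = t_i γ(t_i)⁻¹`, and the image of
`d_3`, by the Hall–Witt identity modulo `G''`, which comes from expanding both sides of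
`[ab, c] = [[a, b] ba, c]` (`hall_witt`).

For the kernel, let `K` be the image under `d_2 : C_2 → C_1` of the submodule of relations. The
group `F_n` acts on `C_1/K` by the affine maps `y ↦ w y + ∇w`. As `∇[v, u] = d_2(∇u ∧ ∇v)`, the
relators act trivially, so `G` acts, and `G'` acts by translations. This gives a map
`alexToQuot : B(G) → C_1/K` whose composite with `toAlex` is `d_2` modulo `K`
(`alexToQuot_toAlex`). Hence an element of the kernel of `toAlex` is the sum of a relation and a
cycle of `d_2`, and by exactness of the standard resolution at `C_2` that cycle is a boundary
(`mem_range_d_of_dTwo_eq_zero`). The exactness is shown by the additive contracting homotopy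
`u e_J ↦ e_J ∧ ∑_{k > max J} ∂(t^u)/∂t_k e_k`, where `t^u = t_1^{u_1} ⋯ t_n^{u_n}`.

The automorphism of a braid sends `t_a` to a conjugate of `t_{π(a)}`, where `π` is the permutation
of the braid (`artin_of`), so a pure braid acts as a basis-conjugating automorphism.
-/

noncomputable section

open scoped commutatorElement

namespace AlexFree

/-! ### Exterior powers -/

section Wedge

variable {n : ℕ}

theorem update_pair_zero {M : Type*} (x y z : M) : Function.update ![x, y] 0 z = ![z, y] := by
  ext i
  fin_cases i <;> rfl

theorem update_pair_one {M : Type*} (x y z : M) : Function.update ![x, y] 1 z = ![x, z] := by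
  ext i
  fin_cases i <;> rfl

/-- The product `C_1 × C_1 → C_2`, `(x, y) ↦ x ∧ y`, as a bilinear map. -/
def wedge : C1 n →ₗ[Lam n] C1 n →ₗ[Lam n] C n 2 :=
  LinearMap.mk₂ (Lam n) (fun x y => exteriorPower.ιMulti (Lam n) 2 ![x, y])
    (fun x x' y => by
      have h := (exteriorPower.ιMulti (Lam n) 2 (M := C1 n)).map_update_add ![x, y] 0 x x'
      simpa only [update_pair_zero] using h)
    (fun c x y => by
      have h := (exteriorPower.ιMulti (Lam n) 2 (M := C1 n)).map_update_smul ![x, y] 0 c x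
      simpa only [update_pair_zero] using h)
    (fun x y y' => by
      have h := (exteriorPower.ιMulti (Lam n) 2 (M := C1 n)).map_update_add ![x, y] 1 y y'
      simpa only [update_pair_one] using h)
    (fun c x y => by
      have h := (exteriorPower.ιMulti (Lam n) 2 (M := C1 n)).map_update_smul ![x, y] 1 c y
      simpa only [update_pair_one] using h)

theorem ιMulti_pair (x y : C1 n) : exteriorPower.ιMulti (Lam n) 2 ![x, y] = wedge x y := rfl

theorem wedge_self (x : C1 n) : wedge x x = 0 :=
  (exteriorPower.ιMulti (Lam n) 2).map_eq_zero_of_eq _ (i := 0) (j := 1) rfl (by simp)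

theorem wedge_swap (x y : C1 n) : wedge x y = -wedge y x := by
  have h := wedge_self (x + y)
  simp only [map_add, LinearMap.add_apply, wedge_self, zero_add, add_zero] at h
  exact eq_neg_of_add_eq_zero_right h

theorem eBasis_apply {k : ℕ} (f : Fin k ↪o Fin n) :
    eBasis n k (Set.powersetCard.ofFinEmbEquiv f) =
      exteriorPower.ιMulti (Lam n) k fun i => e (f i) := by
  rw [eBasis, exteriorPower.basis_apply]
  simp [exteriorPower.ιMulti_family, Function.comp_def]

theorem d_apply {k : ℕ} (f : Fin (k + 1) ↪o Fin n) :
    d n k (exteriorPower.ιMulti (Lam n) (k + 1) fun i => e (f i)) =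
      ∑ r : Fin (k + 1), ((-1 : Lam n) ^ ((k + 1) + ((r : ℕ) + 1)) * (tvar (f r) - 1)) •
        exteriorPower.ιMulti (Lam n) k fun i => e (f (r.succAbove i)) := by
  rw [← eBasis_apply, d, Module.Basis.constr_basis]
  simp

theorem d_two {a b c : Fin n} (hab : a < b) (hbc : b < c) :
    d n 2 (exteriorPower.ιMulti (Lam n) 3 ![e a, e b, e c]) =
      (tvar a - 1) • wedge (e b) (e c) - (tvar b - 1) • wedge (e a) (e c) +
        (tvar c - 1) • wedge (e a) (e b) := by
  have hf : StrictMono ![a, b, c] := by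
    rw [Fin.strictMono_iff_lt_succ]
    intro i
    fin_cases i
    · exact hab
    · exact hbc
  have h := d_apply (OrderEmbedding.ofStrictMono ![a, b, c] hf)
  have h3 : (fun i => e (OrderEmbedding.ofStrictMono ![a, b, c] hf i)) =
      (![e a, e b, e c] : Fin 3 → C1 n) := by
    ext i : 1
    fin_cases i <;> rfl
  have h2 : ∀ r : Fin 3,
      (fun i => e (OrderEmbedding.ofStrictMono ![a, b, c] hf (r.succAbove i))) =
        (![e (![a, b, c] (r.succAbove 0)), e (![a, b, c] (r.succAbove 1))] : Fin 2 → C1 n) := by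
    intro r
    ext i : 1
    fin_cases i <;> rfl
  rw [h3] at h
  rw [h]
  simp only [h2, ιMulti_pair]
  rw [Fin.sum_univ_three]
  simp [Fin.succAbove, pow_succ]
  module

/-- Elements of `C_2` are sums of multiples of the `e_i ∧ e_j` with `i < j`. -/
theorem C2_induction {P : C n 2 → Prop} (add : ∀ x y, P x → P y → P (x + y)) (zero : P 0)
    (smul : ∀ (c : Lam n) (i j : Fin n), i < j → P (c • wedge (e i) (e j))) (x : C n 2) : P x := by
  rw [← (eBasis n 2).sum_repr x]
  refine Finset.sum_induction _ P add zero fun J _ => ?_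
  obtain ⟨f, rfl⟩ := Set.powersetCard.ofFinEmbEquiv.surjective J
  rw [eBasis_apply]
  have h : (fun i => e (f i)) = (![e (f 0), e (f 1)] : Fin 2 → C1 n) := by
    ext i : 1
    fin_cases i <;> rfl
  rw [h, ιMulti_pair]
  exact smul _ _ _ (f.strictMono (by simp))

/-- The linear map on `C_2` with the values `c i j` at `e_i ∧ e_j`, `i < j`. If `c` is alternating,
these are its values for all `i` and `j` (`pairMap_wedge`). -/
def pairMap {N : Type*} [AddCommGroup N] [Module (Lam n) N] (c : Fin n → Fin n → N) :
    C n 2 →ₗ[Lam n] N :=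
  (eBasis n 2).constr ℤ fun J =>
    c (Set.powersetCard.ofFinEmbEquiv.symm J 0) (Set.powersetCard.ofFinEmbEquiv.symm J 1)

theorem pairMap_wedge {N : Type*} [AddCommGroup N] [Module (Lam n) N] {c : Fin n → Fin n → N}
    (hself : ∀ i, c i i = 0) (hswap : ∀ i j, c i j = -c j i) (i j : Fin n) :
    pairMap c (wedge (e i) (e j)) = c i j := by
  have key : ∀ i j : Fin n, i < j → pairMap c (wedge (e i) (e j)) = c i j := by
    intro i j hij
    have hf : StrictMono ![i, j] := by
      rw [Fin.strictMono_iff_lt_succ]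
      intro k
      fin_cases k
      exact hij
    have h : (fun k => e (OrderEmbedding.ofStrictMono ![i, j] hf k)) =
        (![e i, e j] : Fin 2 → C1 n) := by
      ext k : 1
      fin_cases k <;> rfl
    rw [← ιMulti_pair, ← h, ← eBasis_apply, pairMap, Module.Basis.constr_basis]
    simp
  rcases lt_trichotomy i j with h | rfl | h
  · exact key i j h
  · rw [wedge_self, map_zero, hself]
  · rw [wedge_swap, map_neg, key j i h, ← hswap]

end Wedge

/-! ### Abelianized Fox calculus -/

section Fox

variable {n : ℕ}

/-- The monomial of `Λ` that corresponds to an element of `ℤⁿ`. -/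
def mono (v : ZPow n) : Lam n := MonoidAlgebra.single v 1

theorem mono_one : mono (1 : ZPow n) = 1 := rfl

theorem mono_mul (v w : ZPow n) : mono (v * w) = mono v * mono w := by
  simp [mono, MonoidAlgebra.single_mul_single]

theorem mono_tGen (i : Fin n) : mono (tGen i) = tvar i := rfl

theorem foxAb_of (i : Fin n) : foxAb (FreeGroup.of i) = e i := by
  ext1 j
  rw [foxAb, foxGrad_of, e, Pi.basisFun_apply]
  by_cases h : j = i
  · subst h; simp
  · simp [h]

theorem foxAb_mul (u v : F n) : foxAb (u * v) = foxAb u + mono (abF n u) • foxAb v := by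
  ext1 i
  have h : MonoidAlgebra.mapDomainRingHom ℤ (abF n) (MonoidAlgebra.single u 1) =
      mono (abF n u) := by
    simp [mono]
  simp only [foxAb, foxGrad_mul, Pi.add_apply, Pi.smul_apply, smul_eq_mul, map_add, map_mul, h]

theorem foxAb_one : foxAb (1 : F n) = 0 := by
  have h := foxAb_mul (1 : F n) 1
  rw [mul_one, map_one, mono_one, one_smul] at h
  exact left_eq_add.mp h

/-- The first differential `C_1 → Λ`, `e_i ↦ t_i - 1`. -/
def dOne : C1 n →ₗ[Lam n] Lam n := e.constr ℤ fun i => tvar i - 1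

theorem dOne_e (i : Fin n) : dOne (e i) = tvar i - 1 := by
  rw [dOne, Module.Basis.constr_basis]

theorem dOne_foxAb (w : F n) : dOne (foxAb w) = mono (abF n w) - 1 := by
  have h := congrArg (MonoidAlgebra.mapDomainRingHom ℤ (abF n)) (foxGrad_fundamental w)
  simp only [map_sub, map_one, map_sum, map_mul, MonoidAlgebra.mapDomainRingHom_apply,
    MonoidAlgebra.mapDomain_single] at h
  rw [dOne, Module.Basis.constr_apply_fintype, mono, h]
  simp [foxAb, e, tvar, abF]

/-- The second differential, with values in `C_1` itself instead of `⋀¹ C_1`,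
`e_i ∧ e_j ↦ (t_j - 1) e_i - (t_i - 1) e_j`. -/
def dTwo : C n 2 →ₗ[Lam n] C1 n :=
  pairMap fun i j => (tvar j - 1 : Lam n) • e i - (tvar i - 1 : Lam n) • e j

theorem dTwo_wedge (x y : C1 n) : dTwo (wedge x y) = dOne y • x - dOne x • y := by
  have h : (wedge (n := n)).compr₂ dTwo =
      (LinearMap.lsmul (Lam n) (C1 n)).flip.compl₂ dOne -
        (LinearMap.lsmul (Lam n) (C1 n)).comp dOne := by
    refine e.ext fun i => e.ext fun j => ?_
    simp only [LinearMap.compr₂_apply, LinearMap.sub_apply, LinearMap.compl₂_apply,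
      LinearMap.flip_apply, LinearMap.comp_apply, LinearMap.lsmul_apply, dOne_e]
    exact pairMap_wedge
      (c := fun i j => (tvar j - 1 : Lam n) • e i - (tvar i - 1 : Lam n) • e j)
      (fun _ => sub_self _) (fun _ _ => (neg_sub _ _).symm) i j
  simpa using LinearMap.congr_fun₂ h x y

end Fox

/-! ### Exactness of the standard resolution at `C_2` -/

section Exact

variable {n : ℕ}

/-- The element `(u_1, …, u_m, 0, …, 0)` for `u` in `ℤⁿ`. -/
def trunc (m : ℕ) (u : ZPow n) : ZPow n :=
  Multiplicative.ofAdd fun i => if (i : ℕ) < m then Multiplicative.toAdd u i else 0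

theorem trunc_eq_self (u : ZPow n) : trunc n u = u := by
  apply Multiplicative.toAdd.injective
  ext i
  simp [trunc]

theorem trunc_tGen_mul_of_lt {m : ℕ} {i : Fin n} (h : (i : ℕ) < m) (u : ZPow n) :
    trunc m (tGen i * u) = tGen i * trunc m u := by
  apply Multiplicative.toAdd.injective
  ext j
  by_cases hj : j = i
  · subst hj; simp [trunc, tGen, h]
  · simp [trunc, tGen, hj]

theorem trunc_tGen_mul_of_le {m : ℕ} {i : Fin n} (h : m ≤ (i : ℕ)) (u : ZPow n) :
    trunc m (tGen i * u) = trunc m u := by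
  apply Multiplicative.toAdd.injective
  ext j
  by_cases hj : j = i
  · subst hj; simp [trunc, h.not_gt]
  · simp [trunc, tGen, hj]

theorem trunc_succ (k : Fin n) (u : ZPow n) :
    trunc (k + 1) u = trunc k u * tGen k ^ (Multiplicative.toAdd u k) := by
  apply Multiplicative.toAdd.injective
  ext j
  by_cases hj : j = k
  · subst hj; simp [trunc, tGen]
  · have h : j ≤ k ↔ j < k := ⟨fun h => lt_of_le_of_ne h hj, le_of_lt⟩
    simp [trunc, tGen, hj, h]

/-- The geometric sum `(t_k^m - 1) / (t_k - 1)`, for `m` in `ℤ`. -/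
def geom (k : Fin n) (m : ℤ) : Lam n := foxAb (FreeGroup.of k ^ m) k

theorem abF_of (k : Fin n) : abF n (FreeGroup.of k) = tGen k := by simp [abF]

theorem geom_one_add (k : Fin n) (m : ℤ) : geom k (1 + m) = geom k m + mono (tGen k ^ m) := by
  rw [add_comm 1 m, geom, zpow_add_one, foxAb_mul, foxAb_of, map_zpow, abF_of]
  simp [geom, e]

theorem geom_mul (k : Fin n) (m : ℤ) : geom k m * (tvar k - 1) = mono (tGen k ^ m) - 1 := by
  have step : ∀ m : ℤ, geom k (1 + m) * (tvar k - 1) - (mono (tGen k ^ (1 + m)) - 1) =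
      geom k m * (tvar k - 1) - (mono (tGen k ^ m) - 1) := by
    intro m
    rw [geom_one_add, zpow_one_add, mono_mul, mono_tGen]
    ring
  rw [← sub_eq_zero]
  induction m using Int.induction_on with
  | zero => simp [geom, foxAb_one, mono_one]
  | succ m h => rw [add_comm, step, h]
  | pred m h => rw [← step, add_sub_cancel, h]

/-- The additive map `Λ → Λ` with `u ↦ t_1^{u_1} ⋯ t_{k-1}^{u_{k-1}} (t_k^{u_k} - 1) / (t_k - 1)`,
the `k`-th coordinate of the Fox gradient of `t_1^{u_1} ⋯ t_n^{u_n}`. -/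
def partialQuot (k : Fin n) : Lam n →+ Lam n :=
  MonoidAlgebra.liftNC (Int.castAddHom (Lam n))
    fun u => mono (trunc k u) * geom k (Multiplicative.toAdd u k)

theorem partialQuot_mono (k : Fin n) (u : ZPow n) :
    partialQuot k (mono u) = mono (trunc k u) * geom k (Multiplicative.toAdd u k) := by
  simp [partialQuot, mono]

theorem partialQuot_mul_sub_one (k : Fin n) (u : ZPow n) :
    partialQuot k (mono u) * (tvar k - 1) = mono (trunc (k + 1) u) - mono (trunc k u) := by
  rw [partialQuot_mono, mul_assoc, geom_mul, trunc_succ, mono_mul]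
  ring

theorem partialQuot_of_lt {i k : Fin n} (h : i < k) (u : ZPow n) :
    partialQuot k (mono (tGen i * u)) = tvar i * partialQuot k (mono u) := by
  have hk : Multiplicative.toAdd (tGen i * u) k = Multiplicative.toAdd u k := by
    simp [tGen, h.ne']
  rw [partialQuot_mono, partialQuot_mono, trunc_tGen_mul_of_lt h, hk, mono_mul, mono_tGen,
    mul_assoc]

theorem partialQuot_of_gt {i k : Fin n} (h : k < i) (u : ZPow n) :
    partialQuot k (mono (tGen i * u)) = partialQuot k (mono u) := by
  have hk : Multiplicative.toAdd (tGen i * u) k = Multiplicative.toAdd u k := by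
    simp [tGen, h.ne]
  rw [partialQuot_mono, partialQuot_mono, trunc_tGen_mul_of_le h.le, hk]

theorem partialQuot_self (k : Fin n) (u : ZPow n) :
    partialQuot k (mono (tGen k * u)) = partialQuot k (mono u) + mono (trunc (k + 1) u) := by
  have hk : Multiplicative.toAdd (tGen k * u) k = 1 + Multiplicative.toAdd u k := by
    simp [tGen]
  rw [partialQuot_mono, partialQuot_mono, trunc_tGen_mul_of_le le_rfl, hk, geom_one_add,
    trunc_succ, mono_mul]
  ring

theorem sum_partialQuot (j : Fin n) (u : ZPow n) :
    (∑ k, if j < k then partialQuot k (mono u) * (tvar k - 1) else 0) =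
      mono u - mono (trunc (j + 1) u) := by
  -- The sum telescopes; the terms with `k ≤ j` of the extended sum vanish.
  let g : ℕ → Lam n := fun m => mono (trunc (max m (j + 1)) u)
  have h : ∀ k : Fin n, (if j < k then partialQuot k (mono u) * (tvar k - 1) else 0) =
      g (k + 1) - g k := by
    intro k
    split_ifs with hjk
    · have hjk' : (j : ℕ) < k := hjk
      simp only [g, partialQuot_mul_sub_one]
      rw [max_eq_left (by omega), max_eq_left (by omega)]
    · have hjk' : ¬ (j : ℕ) < k := hjk
      simp only [g]
      rw [max_eq_right (by omega), max_eq_right (by omega), sub_self]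
  rw [Finset.sum_congr rfl fun k _ => h k,
    Fin.sum_univ_eq_sum_range (fun m => g (m + 1) - g m) n, Finset.sum_range_sub]
  have hj := j.isLt
  simp only [g]
  rw [max_eq_left (by omega), max_eq_right (by omega), trunc_eq_self]

/-- The contracting homotopy `C_1 → C_2` of the standard resolution,
`u e_i ↦ ∑_{k > i} ∂(t_1^{u_1} ⋯ t_n^{u_n})/∂t_k e_i ∧ e_k` for `u` in `ℤⁿ`. It is additive but not
`Λ`-linear. -/
def homotopy : C1 n →+ C n 2 :=
  AddMonoidHom.mk' (fun y => ∑ i, ∑ k, if i < k then partialQuot k (y i) • wedge (e i) (e k) else 0)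
    (fun x y => by
      simp only [← Finset.sum_add_distrib]
      refine Finset.sum_congr rfl fun i _ => Finset.sum_congr rfl fun k _ => ?_
      split_ifs
      · simp [add_smul]
      · simp)

theorem homotopy_smul_e (c : Lam n) (i : Fin n) :
    homotopy (c • e i) = ∑ k, if i < k then partialQuot k c • wedge (e i) (e k) else 0 := by
  simp only [homotopy, AddMonoidHom.mk'_apply]
  rw [Finset.sum_eq_single i]
  · simp [e]
  · intro j _ hj
    simp [e, hj]
  · simp

/-- On basis elements, `id - h d_2` is the value of `d_3` at
`∑_{k > j} ∂(t_1^{u_1} ⋯ t_n^{u_n})/∂t_k e_i ∧ e_j ∧ e_k`. -/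
theorem sub_homotopy_mem {i j : Fin n} (hij : i < j) (u : ZPow n) :
    mono u • wedge (e i) (e j) - homotopy (dTwo (mono u • wedge (e i) (e j))) ∈
      LinearMap.range (d n 2) := by
  have h1 : dTwo (mono u • wedge (e i) (e j)) =
      mono (tGen j * u) • e i - mono u • e i - (mono (tGen i * u) • e j - mono u • e j) := by
    rw [map_smul, dTwo_wedge, dOne_e, dOne_e, mono_mul, mono_mul, mono_tGen, mono_tGen]
    module
  refine ⟨∑ k, if j < k then partialQuot k (mono u) •
    exteriorPower.ιMulti (Lam n) 3 ![e i, e j, e k] else 0, ?_⟩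
  have h2 : homotopy (mono (tGen j * u) • e i) - homotopy (mono u • e i) =
      mono (trunc (j + 1) u) • wedge (e i) (e j) +
        ∑ k, if j < k then ((tvar j - 1) * partialQuot k (mono u)) • wedge (e i) (e k) else 0 := by
    rw [homotopy_smul_e, homotopy_smul_e, ← Finset.sum_sub_distrib,
      ← Fintype.sum_ite_eq j (fun k => mono (trunc (j + 1) u) • wedge (e i) (e k)),
      ← Finset.sum_add_distrib]
    refine Finset.sum_congr rfl fun k _ => ?_
    rcases lt_trichotomy j k with h | rfl | h
    · rw [if_pos (hij.trans h), if_pos (hij.trans h), if_neg h.ne, if_pos h, partialQuot_of_lt h]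
      module
    · rw [if_pos hij, if_pos hij, if_pos rfl, if_neg (lt_irrefl _), partialQuot_self]
      module
    · rw [if_neg h.ne', if_neg h.not_gt, partialQuot_of_gt h]
      simp
  have h3 : homotopy (mono (tGen i * u) • e j) - homotopy (mono u • e j) =
      ∑ k, if j < k then ((tvar i - 1) * partialQuot k (mono u)) • wedge (e j) (e k) else 0 := by
    rw [homotopy_smul_e, homotopy_smul_e, ← Finset.sum_sub_distrib]
    refine Finset.sum_congr rfl fun k _ => ?_
    split_ifs with h
    · rw [partialQuot_of_lt (hij.trans h)]
      module
    · simp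
  have h4 : mono u • wedge (e i) (e j) = mono (trunc (j + 1) u) • wedge (e i) (e j) +
      ∑ k, if j < k then (partialQuot k (mono u) * (tvar k - 1)) • wedge (e i) (e j) else 0 := by
    have : ∀ k : Fin n,
        (if j < k then (partialQuot k (mono u) * (tvar k - 1)) • wedge (e i) (e j) else 0) =
        (if j < k then partialQuot k (mono u) * (tvar k - 1) else 0) • wedge (e i) (e j) := by
      intro k
      split_ifs <;> simp
    rw [Finset.sum_congr rfl fun k _ => this k, ← Finset.sum_smul, sum_partialQuot]
    module
  rw [h1, map_sub, map_sub, map_sub, h2, h3, h4, map_sum]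
  rw [show ∀ a b c d : C n 2, a + b - (a + c - d) = b - c + d from fun a b c d => by abel,
    ← Finset.sum_sub_distrib, ← Finset.sum_add_distrib]
  refine Finset.sum_congr rfl fun k _ => ?_
  split_ifs with h
  · rw [map_smul, d_two hij h]
    module
  · simp

/-- The standard resolution is exact at `C_2`. -/
theorem mem_range_d_of_dTwo_eq_zero {x : C n 2} (hx : dTwo x = 0) :
    x ∈ LinearMap.range (d n 2) := by
  have key : ∀ x : C n 2, x - homotopy (dTwo x) ∈ LinearMap.range (d n 2) := by
    intro x
    induction x using C2_induction with
    | zero => simp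
    | add x y hx hy =>
      rw [map_add, map_add, add_sub_add_comm]
      exact add_mem hx hy
    | smul c i j hij =>
      induction c using MonoidAlgebra.induction_linear with
      | zero => simp
      | add c c' h h' =>
        rw [add_smul, map_add, map_add, add_sub_add_comm]
        exact add_mem h h'
      | single u m =>
        have h : MonoidAlgebra.single u m • wedge (e i) (e j) =
            m • (mono u • wedge (e i) (e j)) := by
          rw [← smul_assoc]
          simp [mono]
        rw [h, map_zsmul, map_zsmul, ← zsmul_sub]
        exact zsmul_mem (sub_homotopy_mem hij u) m
  simpa [hx] using key x

end Exact

/-! ### The abelianization of `G(α_1, …, α_s)` -/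

section Abelianize

variable {n s : ℕ} {α : Fin s → MulAut (F n)}

theorem zpow_eq_prod (v : ZPow n) : ∏ i, tGen i ^ (Multiplicative.toAdd v i) = v := by
  apply Multiplicative.toAdd.injective
  ext j
  simp [tGen, toAdd_prod, Finset.sum_apply, Pi.single_apply]

/-- The projection `F_n → G(α_1, …, α_s)`. -/
def proj (α : Fin s → MulAut (F n)) : F n →* AutGroup α := PresentedGroup.mk (autRels α)

theorem proj_surjective : Function.Surjective (proj α) := PresentedGroup.mk_surjective _

theorem toAb_abF (w : F n) : toAb α (abF n w) = Abelianization.of (proj α w) := by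
  have h : (toAb α).comp (abF n) = Abelianization.of.comp (proj α) := by
    ext i
    simp [abF, toAb_tGen, proj, PresentedGroup.of]
  exact DFunLike.congr_fun h w

/-- A homomorphism from `F_n` that kills the relators descends to `G(α_1, …, α_s)`. -/
def descend {H : Type*} [Group H] (f : F n →* H) (hf : ∀ r ∈ autRels α, f r = 1) :
    AutGroup α →* H :=
  QuotientGroup.lift (Subgroup.normalClosure (autRels α)) f
    fun _ hx => (Subgroup.normalClosure_le_normal (N := f.ker) hf) hx

variable {z : Fin s → Fin n → F n}

theorem autRels_eq (h : ∀ k, IsBasisConj (α k) (z k)) {r : F n} (hr : r ∈ autRels α) :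
    ∃ k i, r = ⁅FreeGroup.of i, z k i⁆ := by
  obtain ⟨k, i, rfl⟩ := hr
  refine ⟨k, i, ?_⟩
  rw [h k i, commutatorElement_def]
  group

theorem proj_commutator (h : ∀ k, IsBasisConj (α k) (z k)) (k : Fin s) (i : Fin n) :
    proj α ⁅FreeGroup.of i, z k i⁆ = 1 := by
  apply PresentedGroup.mk_eq_one_iff.mpr
  apply Subgroup.subset_normalClosure
  refine ⟨k, i, ?_⟩
  rw [h k i, commutatorElement_def]
  group

theorem map_commutatorElement_eq_one {G H : Type*} [Group G] [CommGroup H] (f : G →* H) (a b : G) :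
    f ⁅a, b⁆ = 1 := by
  rw [map_commutatorElement, commutatorElement_eq_one_iff_mul_comm, mul_comm]

/-- The homomorphism `G(α_1, …, α_s) → ℤⁿ` for basis-conjugating `α_k`. -/
def abG (h : ∀ k, IsBasisConj (α k) (z k)) : AutGroup α →* ZPow n :=
  descend (abF n) fun r hr => by
    obtain ⟨k, i, rfl⟩ := autRels_eq h hr
    exact map_commutatorElement_eq_one _ _ _

theorem abG_proj (h : ∀ k, IsBasisConj (α k) (z k)) (w : F n) : abG h (proj α w) = abF n w := rfl

theorem lift_abG_toAb (h : ∀ k, IsBasisConj (α k) (z k)) (v : ZPow n) :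
    Abelianization.lift (abG h) (toAb α v) = v := by
  conv_rhs => rw [← zpow_eq_prod v]
  simp only [toAb, MonoidHom.coe_mk, OneHom.coe_mk, map_prod, map_zpow,
    Abelianization.lift_apply_of]
  refine Finset.prod_congr rfl fun i _ => ?_
  rw [← abF_of, ← abG_proj h]
  rfl

theorem toAb_bijective (h : ∀ k, IsBasisConj (α k) (z k)) : Function.Bijective (toAb α) := by
  refine ⟨Function.LeftInverse.injective (lift_abG_toAb h), fun a => ?_⟩
  obtain ⟨g, rfl⟩ := QuotientGroup.mk_surjective a
  obtain ⟨w, rfl⟩ := proj_surjective g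
  exact ⟨abF n w, toAb_abF w⟩

end Abelianize

/-! ### Classes of commutators in the Alexander invariant -/

section Classes

variable {n s : ℕ} {α : Fin s → MulAut (F n)}

theorem AlexInv.mk_mul {G : Type*} [Group G] (x y : commutator G) :
    AlexInv.mk (x * y) = AlexInv.mk x + AlexInv.mk y := rfl

theorem AlexInv.mk_inv {G : Type*} [Group G] (x : commutator G) :
    AlexInv.mk x⁻¹ = -AlexInv.mk x := rfl

theorem AlexInv.mk_one {G : Type*} [Group G] : AlexInv.mk (1 : commutator G) = 0 := rfl

theorem mono_smul_mk {v : ZPow n} {g : AutGroup α} (hv : toAb α v = Abelianization.of g)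
    (x : commutator (AutGroup α)) :
    mono v • AlexInv.mk x = AlexInv.mk (MulAut.conjNormal g x) := by
  change MonoidAlgebra.mapDomainRingHom ℤ (toAb α) (mono v) • AlexInv.mk x = _
  rw [mono, MonoidAlgebra.mapDomainRingHom_apply, MonoidAlgebra.mapDomain_single, hv,
    single_smul_mk]

theorem commutatorElement_mem {G : Type*} [Group G] (a b : G) : ⁅a, b⁆ ∈ commutator G :=
  Subgroup.commutator_mem_commutator (Subgroup.mem_top a) (Subgroup.mem_top b)

/-- The class in `B(G)` of the commutator of the images of two elements of `F_n`. -/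
def commClass (α : Fin s → MulAut (F n)) (u v : F n) : AlexInv (AutGroup α) :=
  AlexInv.mk ⟨⁅proj α u, proj α v⁆, commutatorElement_mem _ _⟩

theorem commClass_self (u : F n) : commClass α u u = 0 := by
  rw [← AlexInv.mk_one, commClass]
  refine congrArg AlexInv.mk (Subtype.ext ?_)
  simp

theorem commClass_swap (u v : F n) : commClass α u v = -commClass α v u := by
  rw [commClass, commClass, ← AlexInv.mk_inv]
  refine congrArg AlexInv.mk (Subtype.ext ?_)
  simp

theorem commClass_mul_left (u v w : F n) :
    commClass α (u * v) w = commClass α u w + mono (abF n u) • commClass α v w := by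
  rw [add_comm, commClass, commClass, commClass, mono_smul_mk (toAb_abF u), ← AlexInv.mk_mul]
  refine congrArg AlexInv.mk (Subtype.ext ?_)
  simp only [commutatorElement_def, Subgroup.coe_mul, MulAut.conjNormal_apply, map_mul]
  group

theorem commClass_mul_right (u v w : F n) :
    commClass α w (u * v) = commClass α w u + mono (abF n u) • commClass α w v := by
  rw [commClass_swap, commClass_mul_left, commClass_swap u, commClass_swap v]
  module

theorem commClass_commutatorElement (a b c : F n) :
    commClass α ⁅a, b⁆ c = commClass α a b - mono (abF n c) • commClass α a b := by
  rw [sub_eq_add_neg, commClass, commClass, mono_smul_mk (toAb_abF c), ← AlexInv.mk_inv,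
    ← AlexInv.mk_mul]
  refine congrArg AlexInv.mk (Subtype.ext ?_)
  simp only [commutatorElement_def, Subgroup.coe_mul, Subgroup.coe_inv, MulAut.conjNormal_apply,
    map_mul, map_inv]
  group

/-- The Hall–Witt identity in the Alexander invariant. Both sides of `⁅a b, c⁆ = ⁅⁅a, b⁆ b a, c⁆`
are expanded. -/
theorem hall_witt (a b c : F n) :
    (mono (abF n a) - 1) • commClass α b c - (mono (abF n b) - 1) • commClass α a c +
      (mono (abF n c) - 1) • commClass α a b = 0 := by
  have h : commClass α (a * b) c = commClass α (⁅a, b⁆ * (b * a)) c := by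
    congr 1
    rw [commutatorElement_def]
    group
  rw [commClass_mul_left, commClass_mul_left, commClass_mul_left, commClass_commutatorElement,
    map_commutatorElement_eq_one, mono_one] at h
  rw [← sub_eq_zero] at h
  rw [← h]
  module

/-- A crossed homomorphism on `F_n` that vanishes on the generators is zero. -/
theorem crossed_eq_zero {M : Type*} [AddCommGroup M] [Module (Lam n) M] {D : F n → M}
    (mul : ∀ u v, D (u * v) = D u + mono (abF n u) • D v) (of : ∀ i, D (FreeGroup.of i) = 0)
    (w : F n) : D w = 0 := by
  have one : D 1 = 0 := by
    have h := mul 1 1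
    rw [mul_one, map_one, mono_one, one_smul] at h
    exact left_eq_add.mp h
  induction w using FreeGroup.induction_on with
  | C1 => exact one
  | of i => exact of i
  | inv_of i h =>
    have h1 := mul (FreeGroup.of i)⁻¹ (FreeGroup.of i)
    rw [inv_mul_cancel, one, h, smul_zero, add_zero] at h1
    exact h1.symm
  | mul u v hu hv => rw [mul, hu, hv, smul_zero, add_zero]

/-- The projection `C_2 → B(G)`, `e_i ∧ e_j ↦ [t_j, t_i]`. -/
def toAlex (α : Fin s → MulAut (F n)) : C n 2 →ₗ[Lam n] AlexInv (AutGroup α) :=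
  pairMap fun i j => commClass α (FreeGroup.of j) (FreeGroup.of i)

theorem toAlex_e (i j : Fin n) :
    toAlex α (wedge (e i) (e j)) = commClass α (FreeGroup.of j) (FreeGroup.of i) :=
  pairMap_wedge (c := fun i j => commClass α (FreeGroup.of j) (FreeGroup.of i))
    (fun _ => commClass_self _) (fun _ _ => commClass_swap _ _) i j

/-- The Fox gradients compute all commutators: `∇ u ∧ ∇ v` represents `[v, u]`. -/
theorem toAlex_foxAb (u v : F n) :
    toAlex α (wedge (foxAb u) (foxAb v)) = commClass α v u := by
  have key : ∀ (i : Fin n) (u : F n),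
      toAlex α (wedge (foxAb u) (e i)) - commClass α (FreeGroup.of i) u = 0 := by
    intro i u
    refine crossed_eq_zero
      (D := fun u => toAlex α (wedge (foxAb u) (e i)) - commClass α (FreeGroup.of i) u)
      (fun u v => ?_) (fun j => ?_) u
    · simp only [foxAb_mul, commClass_mul_right, map_add, map_smul, LinearMap.add_apply,
        LinearMap.smul_apply]
      module
    · rw [foxAb_of, toAlex_e, sub_self]
  rw [← sub_eq_zero]
  refine crossed_eq_zero
    (D := fun v => toAlex α (wedge (foxAb u) (foxAb v)) - commClass α v u)
    (fun v w => ?_) (fun i => ?_) v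
  · simp only [foxAb_mul, commClass_mul_left, map_add, map_smul]
    module
  · rw [foxAb_of]
    exact key i u

theorem toAlex_surjective : Function.Surjective (toAlex α) := by
  have key : ∀ g ∈ Subgroup.closure (commutatorSet (AutGroup α)),
      ∀ hg : g ∈ commutator (AutGroup α), AlexInv.mk ⟨g, hg⟩ ∈ LinearMap.range (toAlex α) := by
    intro g hg
    induction hg using Subgroup.closure_induction with
    | mem g h =>
      intro hg
      obtain ⟨a, b, rfl⟩ := h
      obtain ⟨u, rfl⟩ := proj_surjective a
      obtain ⟨v, rfl⟩ := proj_surjective b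
      exact ⟨_, toAlex_foxAb v u⟩
    | one => exact fun _ => zero_mem _
    | mul x y hx hy h h' =>
      intro _
      rw [← commutator_eq_closure] at hx hy
      exact add_mem (h hx) (h' hy)
    | inv x hx h =>
      intro _
      rw [← commutator_eq_closure] at hx
      exact neg_mem (h hx)
  intro b
  obtain ⟨⟨g, hg⟩, rfl⟩ := AlexInv.mk_surjective b
  exact key g (commutator_eq_closure (AutGroup α) ▸ hg) hg

theorem toAlex_d (x : C n 3) : toAlex α (d n 2 x) = 0 := by
  have h : toAlex α ∘ₗ d n 2 = 0 := by
    refine (eBasis n 3).ext fun J => ?_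
    obtain ⟨f, rfl⟩ := Set.powersetCard.ofFinEmbEquiv.surjective J
    have hf : (fun i => e (f i)) = (![e (f 0), e (f 1), e (f 2)] : Fin 3 → C1 n) := by
      ext i : 1
      fin_cases i <;> rfl
    rw [eBasis_apply, hf, LinearMap.comp_apply,
      d_two (f.strictMono (by simp)) (f.strictMono (by simp)), map_add, map_sub, map_smul,
      map_smul, map_smul, toAlex_e, toAlex_e, toAlex_e,
      commClass_swap (FreeGroup.of (f 2)) (FreeGroup.of (f 1)),
      commClass_swap (FreeGroup.of (f 2)) (FreeGroup.of (f 0)),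
      commClass_swap (FreeGroup.of (f 1)) (FreeGroup.of (f 0))]
    have hw := hall_witt (α := α) (FreeGroup.of (f 0)) (FreeGroup.of (f 1)) (FreeGroup.of (f 2))
    simp only [abF_of, mono_tGen] at hw
    rw [LinearMap.zero_apply, ← neg_eq_zero, ← hw]
    module
  exact LinearMap.congr_fun h x

end Classes

/-! ### The presentation -/

section Presentation

variable {n s : ℕ} {α : Fin s → MulAut (F n)} {z : Fin s → Fin n → F n}

theorem Phi_e (y : Fin n → F n) (i : Fin n) : Phi y (e i) = wedge (foxAb (y i)) (e i) := by
  rw [Phi, Module.Basis.constr_basis, ιMulti_pair]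

theorem presMap_apply (x : (Fin s → C1 n) × C n 3) :
    presMap z x = ∑ k, Phi (z k) (x.1 k) + d n 2 x.2 := by
  simp [presMap]

theorem toAlex_presMap (h : ∀ k, IsBasisConj (α k) (z k)) (x : (Fin s → C1 n) × C n 3) :
    toAlex α (presMap z x) = 0 := by
  have hPhi : ∀ k, toAlex α ∘ₗ Phi (z k) = 0 := by
    intro k
    refine e.ext fun i => ?_
    rw [LinearMap.comp_apply, Phi_e, ← foxAb_of i, toAlex_foxAb, LinearMap.zero_apply,
      ← AlexInv.mk_one, commClass]
    refine congrArg AlexInv.mk (Subtype.ext ?_)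
    exact (map_commutatorElement _ _ _).symm.trans (proj_commutator h k i)
  rw [presMap_apply, map_add, toAlex_d, add_zero, map_sum]
  exact Finset.sum_eq_zero fun k _ => LinearMap.congr_fun (hPhi k) (x.1 k)

theorem foxAb_commutatorElement (u v : F n) :
    foxAb ⁅v, u⁆ = dTwo (wedge (foxAb u) (foxAb v)) := by
  have h : foxAb (⁅v, u⁆ * (u * v)) = foxAb (v * u) := by
    congr 1
    rw [commutatorElement_def]
    group
  rw [foxAb_mul, foxAb_mul, foxAb_mul, map_commutatorElement_eq_one, mono_one, one_smul] at h
  rw [dTwo_wedge, dOne_foxAb, dOne_foxAb, eq_sub_of_add_eq h]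
  module

/-- The image in `C_1` of the relations of the presentation, a submodule that contains the Fox
gradients of the relators of `G`. -/
def relSub (z : Fin s → Fin n → F n) : Submodule (Lam n) (C1 n) :=
  (LinearMap.range (presMap z)).map dTwo

theorem dTwo_Phi_mem (k : Fin s) (i : Fin n) :
    dTwo (wedge (foxAb (z k i)) (e i)) ∈ relSub z := by
  refine ⟨_, ⟨(Pi.single k (e i), 0), ?_⟩, rfl⟩
  rw [presMap_apply, map_zero, add_zero, Finset.sum_eq_single k]
  · simp only [Pi.single_eq_same, Phi_e]
  · intro l _ hl
    simp only [Pi.single_eq_of_ne hl, map_zero]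
  · simp

/-- The affine action of `F_n` on `C_1 / K`, `w ↦ (y ↦ w y + ∇ w)`. It is an action because `∇` is a
crossed homomorphism. -/
def foxAction (K : Submodule (Lam n) (C1 n)) : F n →* Equiv.Perm (C1 n ⧸ K) :=
  MonoidHom.toHomPerm
    { toFun := fun w y => mono (abF n w) • y + K.mkQ (foxAb w)
      map_one' := by
        funext y
        simp [mono_one, foxAb_one]
        rfl
      map_mul' := fun u v => by
        funext y
        change _ = mono (abF n u) • (mono (abF n v) • y + K.mkQ (foxAb v)) + K.mkQ (foxAb u)
        rw [foxAb_mul, map_mul, mono_mul, map_add, map_smul]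
        module }

theorem foxAction_apply (K : Submodule (Lam n) (C1 n)) (w : F n) (y : C1 n ⧸ K) :
    foxAction K w y = mono (abF n w) • y + K.mkQ (foxAb w) := rfl

/-- The affine action of `G` on the quotient of `C_1` by the image of the relations. -/
def groupAction (h : ∀ k, IsBasisConj (α k) (z k)) :
    AutGroup α →* Equiv.Perm (C1 n ⧸ relSub z) :=
  descend (foxAction (relSub z)) fun r hr => by
    obtain ⟨k, i, rfl⟩ := autRels_eq h hr
    ext1 y
    have h0 : (relSub z).mkQ (foxAb ⁅FreeGroup.of i, z k i⁆) = 0 := by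
      rw [foxAb_commutatorElement, foxAb_of, Submodule.mkQ_apply, Submodule.Quotient.mk_eq_zero]
      exact dTwo_Phi_mem k i
    rw [foxAction_apply, h0, map_commutatorElement_eq_one, mono_one, one_smul, add_zero]
    rfl

theorem groupAction_proj (h : ∀ k, IsBasisConj (α k) (z k)) (w : F n) (y : C1 n ⧸ relSub z) :
    groupAction h (proj α w) y = mono (abF n w) • y + (relSub z).mkQ (foxAb w) := rfl

theorem groupAction_apply (h : ∀ k, IsBasisConj (α k) (z k)) (g : AutGroup α)
    (y : C1 n ⧸ relSub z) : groupAction h g y = mono (abG h g) • y + groupAction h g 0 := by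
  obtain ⟨w, rfl⟩ := proj_surjective g
  rw [groupAction_proj, groupAction_proj, smul_zero, zero_add, abG_proj]

theorem groupAction_of_mem (h : ∀ k, IsBasisConj (α k) (z k)) {g : AutGroup α}
    (hg : g ∈ commutator (AutGroup α)) (y : C1 n ⧸ relSub z) :
    groupAction h g y = y + groupAction h g 0 := by
  have h1 : abG h g = 1 := Abelianization.commutator_subset_ker (abG h) hg
  rw [groupAction_apply, h1, mono_one, one_smul]

/-- The additive map from `B(G)` to the quotient of `C_1` by the image of the relations that is
induced by the Fox gradient. -/
def alexToQuot (h : ∀ k, IsBasisConj (α k) (z k)) :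
    AlexInv (AutGroup α) →+ C1 n ⧸ relSub z :=
  MonoidHom.toAdditiveLeft (Abelianization.lift
    { toFun := fun x : commutator (AutGroup α) => Multiplicative.ofAdd (groupAction h x 0)
      map_one' := by simp
      map_mul' := fun x y => by
        rw [← ofAdd_add, Subgroup.coe_mul, map_mul, Equiv.Perm.mul_apply,
          groupAction_of_mem h x.2, add_comm] })

theorem alexToQuot_mk (h : ∀ k, IsBasisConj (α k) (z k)) (x : commutator (AutGroup α)) :
    alexToQuot h (AlexInv.mk x) = groupAction h x 0 := rfl

theorem alexToQuot_commClass (h : ∀ k, IsBasisConj (α k) (z k)) (u v : F n) :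
    alexToQuot h (commClass α u v) = (relSub z).mkQ (foxAb ⁅u, v⁆) := by
  change groupAction h ⁅proj α u, proj α v⁆ 0 = _
  rw [← map_commutatorElement, groupAction_proj, smul_zero, zero_add]

theorem alexToQuot_mono_smul (h : ∀ k, IsBasisConj (α k) (z k)) (v : ZPow n)
    (b : AlexInv (AutGroup α)) : alexToQuot h (mono v • b) = mono v • alexToQuot h b := by
  obtain ⟨x, rfl⟩ := AlexInv.mk_surjective b
  obtain ⟨g, hg⟩ := QuotientGroup.mk_surjective (toAb α v)
  have hv : abG h g = v := by
    rw [← lift_abG_toAb h v, ← hg]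
    rfl
  rw [mono_smul_mk hg.symm, alexToQuot_mk, alexToQuot_mk, MulAut.conjNormal_apply, map_mul,
    map_mul, Equiv.Perm.mul_apply, Equiv.Perm.mul_apply, groupAction_of_mem h x.2,
    groupAction_apply, hv, smul_add, add_right_comm, ← hv, ← groupAction_apply,
    ← Equiv.Perm.mul_apply, ← map_mul, mul_inv_cancel, map_one, Equiv.Perm.one_apply, zero_add]

theorem alexToQuot_smul (h : ∀ k, IsBasisConj (α k) (z k)) (c : Lam n)
    (b : AlexInv (AutGroup α)) : alexToQuot h (c • b) = c • alexToQuot h b := by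
  induction c using MonoidAlgebra.induction_linear with
  | zero => simp
  | add c c' hc hc' => rw [add_smul, map_add, hc, hc', add_smul]
  | single v m =>
    have hm : MonoidAlgebra.single v m = m • (mono v : Lam n) := by simp [mono]
    rw [hm, smul_assoc, smul_assoc, map_zsmul, alexToQuot_mono_smul]

theorem alexToQuot_toAlex (h : ∀ k, IsBasisConj (α k) (z k)) (x : C n 2) :
    alexToQuot h (toAlex α x) = (relSub z).mkQ (dTwo x) := by
  induction x using C2_induction with
  | zero => simp
  | add x y hx hy => simp only [map_add, hx, hy]
  | smul c i j _ =>
    rw [map_smul, alexToQuot_smul, map_smul, map_smul, toAlex_e, alexToQuot_commClass,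
      foxAb_commutatorElement, foxAb_of, foxAb_of]

/-- The exact sequence `C_1^s ⊕ C_3 → C_2 → B(G) → 0`. -/
theorem isPresentedBy (h : ∀ k, IsBasisConj (α k) (z k)) :
    IsPresentedBy (presMap z) (AlexInv (AutGroup α)) := by
  refine ⟨toAlex α, fun x => ⟨fun hx => ?_, ?_⟩, toAlex_surjective⟩
  · have h1 : dTwo x ∈ relSub z := by
      rw [← Submodule.Quotient.mk_eq_zero, ← Submodule.mkQ_apply, ← alexToQuot_toAlex h, hx,
        map_zero]
    obtain ⟨y, ⟨y', hy'⟩, hy⟩ := h1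
    obtain ⟨c, hc⟩ := mem_range_d_of_dTwo_eq_zero (x := x - y) (by rw [map_sub, hy, sub_self])
    refine ⟨y' + (0, c), ?_⟩
    have h2 : presMap z (0, c) = d n 2 c := by simp [presMap_apply]
    rw [map_add, hy', h2, hc, add_sub_cancel]
  · rintro ⟨y, rfl⟩
    exact toAlex_presMap h y

theorem nonempty_basis_C (n k : ℕ) :
    Nonempty (Module.Basis (Fin (n.choose k)) (Lam n) (C n k)) :=
  ⟨(eBasis n k).reindex (Finite.equivFinOfCardEq (by rw [Set.powersetCard.card, Nat.card_fin]))⟩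

theorem nonempty_basis_relations (n s : ℕ) :
    Nonempty (Module.Basis (Fin (n.choose 3 + n * s)) (Lam n) ((Fin s → C1 n) × C n 3)) := by
  obtain ⟨b⟩ := nonempty_basis_C n 3
  refine ⟨((Pi.basis fun _ : Fin s => e).prod b).reindex (Fintype.equivFinOfCardEq ?_)⟩
  simp
  ring

end Presentation

/-! ### Pure braids -/

section Braid

variable {n : ℕ}

/-- A braid maps each generator to a conjugate of a generator, as its permutation prescribes. -/
theorem artin_of (β : BraidGroup n) (a : Fin n) :
    ∃ w : F n, artin n β (FreeGroup.of a) = w * FreeGroup.of (braidPerm n β a) * w⁻¹ := by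
  have mul : ∀ β β' : BraidGroup n,
      (∀ a, ∃ w : F n, artin n β (FreeGroup.of a) = w * FreeGroup.of (braidPerm n β a) * w⁻¹) →
      (∀ a, ∃ w : F n,
        artin n β' (FreeGroup.of a) = w * FreeGroup.of (braidPerm n β' a) * w⁻¹) →
      ∀ a, ∃ w : F n,
        artin n (β * β') (FreeGroup.of a) = w * FreeGroup.of (braidPerm n (β * β') a) * w⁻¹ := by
    intro β β' h h' a
    obtain ⟨w', hw'⟩ := h' a
    obtain ⟨w, hw⟩ := h (braidPerm n β' a)
    refine ⟨artin n β w' * w, ?_⟩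
    rw [map_mul, map_mul, MulAut.mul_apply, Equiv.Perm.mul_apply, hw', map_mul, map_mul, hw,
      map_inv]
    group
  have inv : ∀ β : BraidGroup n,
      (∀ a, ∃ w : F n, artin n β (FreeGroup.of a) = w * FreeGroup.of (braidPerm n β a) * w⁻¹) →
      ∀ a, ∃ w : F n,
        artin n β⁻¹ (FreeGroup.of a) = w * FreeGroup.of (braidPerm n β⁻¹ a) * w⁻¹ := by
    intro β h a
    obtain ⟨w, hw⟩ := h (braidPerm n β⁻¹ a)
    refine ⟨(artin n β⁻¹ w)⁻¹, ?_⟩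
    have h1 := congrArg (artin n β⁻¹) hw
    rw [← MulAut.mul_apply, ← map_mul, ← Equiv.Perm.mul_apply, ← map_mul, inv_mul_cancel,
      mul_inv_cancel, map_one, map_one, MulAut.one_apply, Equiv.Perm.one_apply, map_mul, map_mul,
      map_inv (artin n β⁻¹) w] at h1
    rw [h1]
    group
  have gen : ∀ (i : Fin (n - 1)) (a : Fin n), ∃ w : F n,
      artin n (PresentedGroup.of i) (FreeGroup.of a) =
        w * FreeGroup.of (braidPerm n (PresentedGroup.of i) a) * w⁻¹ := by
    intro i a
    have h1 : artin n (PresentedGroup.of i) = artinGen i := by simp [artin]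
    have h2 : braidPerm n (PresentedGroup.of i) = Equiv.swap (lo i) (hi i) := by simp [braidPerm]
    rw [h1, h2, artinGen_of]
    split_ifs with hlo hhi
    · exact ⟨FreeGroup.of (lo i), by rw [hlo, Equiv.swap_apply_left]⟩
    · exact ⟨1, by rw [hhi, Equiv.swap_apply_right]; group⟩
    · exact ⟨1, by rw [Equiv.swap_apply_of_ne_of_ne hlo hhi]; group⟩
  obtain ⟨x, rfl⟩ := PresentedGroup.mk_surjective _ β
  revert a
  induction x using FreeGroup.induction_on with
  | C1 => exact fun a => ⟨1, by simp⟩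
  | of i => exact gen i
  | inv_of i h =>
    rw [map_inv]
    exact inv _ h
  | mul x y hx hy =>
    rw [map_mul]
    exact mul _ _ hx hy

theorem exists_isBasisConj_artin {β : BraidGroup n} (hβ : β ∈ pureBraid n) :
    ∃ z : Fin n → F n, IsBasisConj (artin n β) z := by
  choose z hz using artin_of β
  have h : braidPerm n β = 1 := hβ
  exact ⟨z, fun i => by rw [hz, h, Equiv.Perm.one_apply]⟩

end Braid

end AlexFree
end

theorem theorem3p5 (n : ℕ) :
    (∀ (s : ℕ) (z : Fin s → Fin n → AlexFree.F n) (γ : Fin s → MulAut (AlexFree.F n)),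
      (∀ k, AlexFree.IsBasisConj (γ k) (z k)) →
        Function.Bijective (AlexFree.toAb γ) ∧
        AlexFree.IsPresentedBy (AlexFree.presMap z) (AlexFree.AlexInv (AlexFree.AutGroup γ)) ∧
        Nonempty (Module.Basis (Fin (n.choose 2)) (AlexFree.Lam n) (AlexFree.C n 2)) ∧
        Nonempty (Module.Basis (Fin (n.choose 3 + n * s)) (AlexFree.Lam n)
          ((Fin s → AlexFree.C1 n) × AlexFree.C n 3))) ∧
    (∀ β ∈ AlexFree.pureBraid n,
      ∃ z : Fin n → AlexFree.F n,
        AlexFree.IsBasisConj (AlexFree.artin n β) z ∧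
        Function.Bijective (AlexFree.toAb fun _ : Fin 1 => AlexFree.artin n β) ∧
        AlexFree.IsPresentedBy (AlexFree.presMap fun _ : Fin 1 => z)
          (AlexFree.AlexInv (AlexFree.AutGroup fun _ : Fin 1 => AlexFree.artin n β))) := by
  refine ⟨fun s z γ h => ⟨AlexFree.toAb_bijective h, AlexFree.isPresentedBy h,
    AlexFree.nonempty_basis_C n 2, AlexFree.nonempty_basis_relations n s⟩, fun β hβ => ?_⟩
  obtain ⟨z, hz⟩ := AlexFree.exists_isBasisConj_artin hβ
  exact ⟨z, hz, AlexFree.toAb_bijective fun _ => hz, AlexFree.isPresentedBy fun _ => hz⟩
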